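/- Let $E_1,E_2,\dots$ be independent standard exponential random variables (density $e^{-x}$ on $x>0$) on a probability space, and let $\gamma>0$ and $\tau>0$ be real numbers. Put $f(j)=j^{\tau}$ for integers $j\ge 0$, $\Delta f(j)=f(j)-f(j-1)=j^{\tau}-(j-1)^{\tau}$ for $j\ge 1$, $\alpha(k)=k^{1-\tau}$ for $k\ge1$, and $\mu=\dfrac{\tau}{\tau+\gamma}$. Then, as $k\to+\infty$, $$\frac1k\sum_{j=1}^{k-1}\alpha(k)\,\Delta f(j)\;\mathbb{E}\exp\Bigl(-\gamma\sum_{h=j}^{k-1}\frac{E_h}{h}\Bigr)\longrightarrow\mu ,$$ and $$\frac1{k^{\tau}}\sum_{j=1}^{k-1}\bigl(j^{\tau}-(j-1)^{\tau}\bigr)\exp\Bigl(-\gamma\sum_{h=j}^{k-1}\frac{E_h}{h}\Bigr)\longrightarrow\mu=\frac{\tau}{\tau+\gamma}\qquad\text{almost surely.}$$ -/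

import Mathlib

open MeasureTheory ProbabilityTheory Filter Topology

/-! Let `S k` be the sum of `E h / h` over `1 ≤ h < k`. The variances of `(E h - 1) / h` are
summable, so Kolmogorov's one-series theorem (`ae_exists_tendsto_sum`) makes `S k - log k` converge
almost surely. Hence `exp (γ * S k) = k ^ γ * b k`, where `b` has a positive random limit. The
discounted sum is then the sum of `Δf(j) * j ^ γ * b j`, divided by `k ^ (τ + γ) * b k`. As `Δf(j) *
j ^ γ` is asymptotic to `τ / (τ + γ)` times the increment of `j ^ (τ + γ)`, a Toeplitz argument
(`tendsto_weighted_sum`) applies, and the random limit of `b` cancels. The averaged statement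
follows by dominated convergence, since the random means lie in `[0, 1]` almost surely. -/

/-- The density of the exponential law times a power, as an integrand of the Gamma integral. -/
lemma exponentialPDF_toReal_smul_pow_ae_eq (n : ℕ) :
    (fun x : ℝ => (exponentialPDF 1 x).toReal • x ^ n) =ᵐ[volume]
      (Set.Ioi (0 : ℝ)).indicator (fun x => Real.exp (-x) * x ^ (((n : ℝ) + 1) - 1)) := by
  have h0 : ∀ᵐ x : ℝ, x ≠ 0 := by simp [ae_iff]
  filter_upwards [h0] with x hx
  rcases lt_or_gt_of_ne hx with h | h
  · rw [exponentialPDF_of_neg h, Set.indicator_of_notMem (by simpa using h.le)]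
    simp
  · rw [exponentialPDF_of_nonneg h.le, Set.indicator_of_mem (by simpa using h),
      ENNReal.toReal_ofReal (by positivity)]
    simp

lemma measurable_exponentialPDF (r : ℝ) : Measurable (exponentialPDF r) :=
  (measurable_exponentialPDFReal r).ennreal_ofReal

lemma exponentialPDF_lt_top (r x : ℝ) : exponentialPDF r x < ⊤ := ENNReal.ofReal_lt_top

lemma expMeasure_eq_withDensity (r : ℝ) :
    expMeasure r = volume.withDensity (exponentialPDF r) := rfl

lemma integrable_pow_expMeasure (n : ℕ) : Integrable (fun x : ℝ => x ^ n) (expMeasure 1) := by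
  rw [expMeasure_eq_withDensity, integrable_withDensity_iff_integrable_smul'
    (measurable_exponentialPDF 1) (ae_of_all _ fun x => exponentialPDF_lt_top 1 x),
    integrable_congr (exponentialPDF_toReal_smul_pow_ae_eq n),
    integrable_indicator_iff measurableSet_Ioi]
  exact Real.GammaIntegral_convergent (by positivity)

lemma integral_id_expMeasure : ∫ x : ℝ, x ∂(expMeasure 1) = 1 := by
  have h := integral_congr_ae (exponentialPDF_toReal_smul_pow_ae_eq 1)
  simp only [pow_one] at h
  rw [expMeasure_eq_withDensity, integral_withDensity_eq_integral_toReal_smul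
    (measurable_exponentialPDF 1) (ae_of_all _ fun x => exponentialPDF_lt_top 1 x), h,
    integral_indicator measurableSet_Ioi, ← Real.Gamma_eq_integral (by positivity)]
  norm_num [Real.Gamma_two]

lemma memLp_two_id_expMeasure : MemLp (fun x : ℝ => x) 2 (expMeasure 1) :=
  (memLp_two_iff_integrable_sq measurable_id.aestronglyMeasurable).2 (integrable_pow_expMeasure 2)

lemma ae_nonneg_expMeasure : ∀ᵐ x : ℝ ∂(expMeasure 1), 0 ≤ x := by
  rw [expMeasure_eq_withDensity, ae_withDensity_iff (measurable_exponentialPDF 1)]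
  refine ae_of_all _ fun x hx => ?_
  by_contra h
  exact hx (exponentialPDF_of_neg (not_le.1 h))

/-! ### Kolmogorov's one-series theorem by martingale convergence -/

section Convergence

variable {Ω : Type*} [MeasurableSpace Ω] {P : Measure Ω} [IsProbabilityMeasure P]

/-- Partial sums of independent centered variables form a martingale. -/
lemma martingale_sum_of_iIndepFun {X : ℕ → Ω → ℝ} (hX : ∀ i, StronglyMeasurable (X i))
    (hind : iIndepFun X P) (hint : ∀ i, Integrable (X i) P) (hmean : ∀ i, ∫ ω, X i ω ∂P = 0) :
    Martingale (fun n => ∑ i ∈ Finset.range (n + 1), X i) (Filtration.natural X hX) P := by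
  refine martingale_of_condExp_sub_eq_zero_nat ?_ (fun n => integrable_finsetSum' _ fun i _ => hint i) ?_
  · intro n
    refine Finset.stronglyMeasurable_sum _ fun i hi => ?_
    exact (Filtration.stronglyAdapted_natural hX i).mono
      ((Filtration.natural X hX).mono (by simpa [Nat.lt_succ_iff] using hi))
  · intro n
    have h := hind.condExp_natural_ae_eq_of_lt hX (Nat.lt_succ_self n)
    have e : (∑ i ∈ Finset.range (n + 1 + 1), X i) - ∑ i ∈ Finset.range (n + 1), X i
        = X (n + 1) := by
      rw [Finset.sum_range_succ _ (n + 1)]; simp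
    rw [e]
    filter_upwards [h] with ω hω
    rw [Nat.succ_eq_add_one] at hω
    rw [hω, hmean]; rfl

/-- Kolmogorov's one-series theorem, for strongly measurable variables. -/
lemma ae_exists_tendsto_sum_of_stronglyMeasurable {X : ℕ → Ω → ℝ}
    (hX : ∀ i, StronglyMeasurable (X i)) (hind : iIndepFun X P) (hL2 : ∀ i, MemLp (X i) 2 P)
    (hmean : ∀ i, ∫ ω, X i ω ∂P = 0) (hvar : Summable fun i => Var[X i; P]) :
    ∀ᵐ ω ∂P, ∃ c, Tendsto (fun n => ∑ i ∈ Finset.range n, X i ω) atTop (𝓝 c) := by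
  have hint : ∀ i, Integrable (X i) P := fun i => (hL2 i).integrable one_le_two
  have hM := martingale_sum_of_iIndepFun hX hind hint hmean
  have hbdd : ∀ n, eLpNorm (∑ i ∈ Finset.range (n + 1), X i) 1 P
      ≤ ((Real.toNNReal (1 + ∑' i, Var[X i; P]) : NNReal) : ENNReal) := by
    intro n
    set S : Ω → ℝ := ∑ i ∈ Finset.range (n + 1), X i with hS
    have hS2 : MemLp S 2 P := memLp_finsetSum' _ fun i _ => hL2 i
    have hS1 : Integrable S P := hS2.integrable one_le_two
    have hvarS : Var[S; P] ≤ ∑' i, Var[X i; P] := by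
      rw [hS, IndepFun.variance_sum (fun i _ => hL2 i) (fun i _ j _ hij => hind.indepFun hij)]
      exact hvar.sum_le_tsum _ fun i _ => variance_nonneg _ _
    have hmS : ∫ ω, S ω ∂P = 0 := by
      rw [hS]
      simp only [Finset.sum_apply]
      rw [integral_finsetSum _ fun i _ => hint i]
      exact Finset.sum_eq_zero fun i _ => hmean i
    rw [variance_of_integral_eq_zero hS1.aemeasurable hmS] at hvarS
    rw [eLpNorm_one_eq_lintegral_enorm, ← ofReal_integral_norm_eq_lintegral_enorm hS1]
    refine ENNReal.ofReal_le_ofReal ?_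
    -- The bound `|S| ≤ 1 + S ^ 2` turns the variance bound into the `L¹` bound that submartingale
    -- convergence needs.
    have h1 : ∫ ω, ‖S ω‖ ∂P ≤ ∫ ω, (1 + S ω ^ 2) ∂P := by
      refine integral_mono hS1.norm ((integrable_const _).add hS2.integrable_sq) fun ω => ?_
      simp only [Real.norm_eq_abs]
      nlinarith [sq_abs (S ω), sq_nonneg (|S ω| - 1)]
    rw [integral_add (integrable_const _) hS2.integrable_sq] at h1
    simp only [integral_const, probReal_univ, smul_eq_mul, mul_one] at h1
    linarith
  filter_upwards [hM.submartingale.exists_ae_tendsto_of_bdd hbdd] with ω ⟨c, hc⟩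
  refine ⟨c, (tendsto_add_atTop_iff_nat 1).1 ?_⟩
  simpa only [Finset.sum_apply] using hc

/-- Kolmogorov's one-series theorem. -/
theorem ae_exists_tendsto_sum {X : ℕ → Ω → ℝ} (hind : iIndepFun X P)
    (hL2 : ∀ i, MemLp (X i) 2 P) (hmean : ∀ i, ∫ ω, X i ω ∂P = 0)
    (hvar : Summable fun i => Var[X i; P]) :
    ∀ᵐ ω ∂P, ∃ c, Tendsto (fun n => ∑ i ∈ Finset.range n, X i ω) atTop (𝓝 c) := by
  have hsm : ∀ i, AEStronglyMeasurable (X i) P := fun i => (hL2 i).1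
  have hae : ∀ i, X i =ᵐ[P] (hsm i).mk := fun i => (hsm i).ae_eq_mk
  have h := ae_exists_tendsto_sum_of_stronglyMeasurable (P := P) (X := fun i => (hsm i).mk)
    (fun i => (hsm i).stronglyMeasurable_mk) (hind.congr hae)
    (fun i => (hL2 i).ae_eq (hae i)) (fun i => (integral_congr_ae (hae i)).symm.trans (hmean i))
    (by simpa only [← variance_congr (hae _)] using hvar)
  filter_upwards [h, ae_all_iff.2 hae] with ω hω he
  simpa only [he] using hω

end Convergence

/-! ### Pathwise asymptotics of weighted means -/

section Deterministic

/-- By homogeneity the quotient is the slope of `x ^ s` between `1` and `i / (i + 1)`, which tends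
to the derivative at `1`. -/
lemma tendsto_rpow_increment_div (s : ℝ) :
    Tendsto (fun i : ℕ => (((i : ℝ) + 1) ^ s - (i : ℝ) ^ s) / ((i : ℝ) + 1) ^ (s - 1))
      atTop (𝓝 s) := by
  have hd : HasDerivAt (fun x : ℝ => x ^ s) s 1 := by
    simpa using Real.hasDerivAt_rpow_const (x := 1) (p := s) (Or.inl one_ne_zero)
  have hx : Tendsto (fun i : ℕ => (i : ℝ) / ((i : ℝ) + 1)) atTop (𝓝[≠] 1) := by
    refine tendsto_nhdsWithin_iff.2 ⟨tendsto_natCast_div_add_atTop 1, Eventually.of_forall ?_⟩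
    intro i
    have : (0 : ℝ) < (i : ℝ) + 1 := by positivity
    simp only [Set.mem_compl_iff, Set.mem_singleton_iff]
    rw [div_eq_one_iff_eq this.ne']
    linarith
  refine (hd.tendsto_slope.comp hx).congr fun i => ?_
  have h1 : (0 : ℝ) < (i : ℝ) + 1 := by positivity
  have h2 := Real.rpow_pos_of_pos h1 s
  simp only [Function.comp, slope_def_field, Real.one_rpow]
  rw [Real.div_rpow (by positivity) h1.le, Real.rpow_sub_one h1.ne']
  have h3 : (i : ℝ) / ((i : ℝ) + 1) - 1 = -(1 / ((i : ℝ) + 1)) := by field_simp; ring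
  rw [h3]
  field_simp
  ring

/-- A Toeplitz-type weighted mean: weights `Δ(j ^ τ) j ^ γ` against a convergent sequence. -/
lemma tendsto_weighted_sum {γ τ B : ℝ} (hγ : 0 < γ) (hτ : 0 < τ) {b : ℕ → ℝ}
    (hb : Tendsto b atTop (𝓝 B)) :
    Tendsto (fun k : ℕ => (∑ j ∈ Finset.Ico 1 k,
        ((j : ℝ) ^ τ - ((j : ℝ) - 1) ^ τ) * (j : ℝ) ^ γ * b j) / (k : ℝ) ^ (τ + γ))
      atTop (𝓝 (τ / (τ + γ) * B)) := by
  have hs : 0 < τ + γ := by positivity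
  set D : ℕ → ℝ := fun i => ((i : ℝ) + 1) ^ (τ + γ) - (i : ℝ) ^ (τ + γ) with hD
  set w : ℕ → ℝ := fun i => (((i : ℝ) + 1) ^ τ - (i : ℝ) ^ τ) * ((i : ℝ) + 1) ^ γ with hw
  have hDpos : ∀ i, 0 < D i := fun i =>
    sub_pos.2 (Real.rpow_lt_rpow (by positivity) (by linarith) hs)
  have hDsum : ∀ n, ∑ i ∈ Finset.range n, D i = (n : ℝ) ^ (τ + γ) := by
    intro n
    have := Finset.sum_range_sub (fun i : ℕ => (i : ℝ) ^ (τ + γ)) n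
    simpa [hD, Real.zero_rpow hs.ne'] using this
  have hpow : Tendsto (fun n : ℕ => (n : ℝ) ^ (τ + γ)) atTop atTop :=
    (tendsto_rpow_atTop hs).comp tendsto_natCast_atTop_atTop
  have hratio : Tendsto (fun i => w i / D i) atTop (𝓝 (τ / (τ + γ))) := by
    refine ((tendsto_rpow_increment_div τ).div (tendsto_rpow_increment_div (τ + γ)) hs.ne').congr
      fun i => ?_
    have h1 : (0 : ℝ) < (i : ℝ) + 1 := by positivity
    have h2 : ((i : ℝ) + 1) ^ (τ + γ - 1) = ((i : ℝ) + 1) ^ (τ - 1) * ((i : ℝ) + 1) ^ γ := by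
      rw [← Real.rpow_add h1]; ring_nf
    have h3 := Real.rpow_pos_of_pos h1 (τ - 1)
    have h4 := Real.rpow_pos_of_pos h1 γ
    have h5 := (hDpos i).ne'
    simp only [hw, Pi.div_apply, h2]
    change _ / (D i / _) = _
    field_simp
  have hb1 : Tendsto (fun i => b (1 + i)) atTop (𝓝 B) := by
    simpa only [add_comm] using (tendsto_add_atTop_iff_nat 1).2 hb
  -- Stolz–Cesàro in little-o form: termwise errors `o(D i)` sum to `o` of the divergent sum of `D`.
  have hlo : (fun i => w i * b (1 + i) - τ / (τ + γ) * B * D i) =o[atTop] D := by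
    refine (Asymptotics.isLittleO_iff_tendsto fun i h => absurd h (hDpos i).ne').2 ?_
    have := (hratio.mul hb1).sub_const (τ / (τ + γ) * B)
    rw [sub_self] at this
    refine this.congr fun i => ?_
    have h5 := (hDpos i).ne'
    field_simp
  have hsum := hlo.sum_range (fun i => (hDpos i).le) (by simpa only [hDsum] using hpow)
  simp only [Finset.sum_sub_distrib, ← Finset.mul_sum, hDsum] at hsum
  have hlim := hsum.tendsto_div_nhds_zero.add_const (τ / (τ + γ) * B)
  rw [zero_add] at hlim
  -- At `k = n + 1` the sum has `n` terms, so the normaliser `n ^ (τ + γ)` must be replaced by `(n +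
  -- 1) ^ (τ + γ)`.
  have hq : Tendsto (fun n : ℕ => ((n : ℝ) / ((n : ℝ) + 1)) ^ (τ + γ)) atTop (𝓝 1) := by
    simpa using (tendsto_natCast_div_add_atTop (1 : ℝ)).rpow_const (p := τ + γ) (Or.inr hs.le)
  have hfin := hlim.mul hq
  rw [mul_one] at hfin
  refine (tendsto_add_atTop_iff_nat 1).1 (hfin.congr' ?_)
  filter_upwards [eventually_gt_atTop 0] with n hn
  have hn0 : (0 : ℝ) < n := by exact_mod_cast hn
  have h1 := Real.rpow_pos_of_pos hn0 (τ + γ)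
  have h2 : (0 : ℝ) < ((n : ℝ) + 1) ^ (τ + γ) := by positivity
  rw [Finset.sum_Ico_eq_sum_range, Nat.add_sub_cancel, Real.div_rpow hn0.le (by positivity)]
  have h3 : ∑ i ∈ Finset.range n, ((((1 + i : ℕ) : ℝ)) ^ τ - (((1 + i : ℕ) : ℝ) - 1) ^ τ)
      * ((1 + i : ℕ) : ℝ) ^ γ * b (1 + i) = ∑ i ∈ Finset.range n, w i * b (1 + i) := by
    refine Finset.sum_congr rfl fun i _ => ?_
    have h4 : ((1 + i : ℕ) : ℝ) = (i : ℝ) + 1 := by push_cast; ring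
    rw [h4, add_sub_cancel_right]
  rw [h3]
  push_cast
  field_simp
  ring

/-- If `∑ (e h - 1) / h` converges, then the discounted mean converges to `τ / (τ + γ)`. -/
lemma tendsto_discounted_mean {γ τ c : ℝ} (hγ : 0 < γ) (hτ : 0 < τ) {e : ℕ → ℝ}
    (he : Tendsto (fun n => ∑ i ∈ Finset.range n, (e (i + 1) - 1) / ((i : ℝ) + 1)) atTop (𝓝 c)) :
    Tendsto (fun k : ℕ => (1 / (k : ℝ) ^ τ) * ∑ j ∈ Finset.Ico 1 k,
        ((j : ℝ) ^ τ - ((j : ℝ) - 1) ^ τ) *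
          Real.exp (-γ * ∑ h ∈ Finset.Ico j k, e h / (h : ℝ)))
      atTop (𝓝 (τ / (τ + γ))) := by
  set S : ℕ → ℝ := fun k => ∑ h ∈ Finset.Ico 1 k, e h / (h : ℝ) with hS
  -- Adding back the harmonic sum removed by centering brings in Euler's constant.
  have hSlog : Tendsto (fun k : ℕ => S k - Real.log k) atTop
      (𝓝 (c + Real.eulerMascheroniConstant)) := by
    refine (tendsto_add_atTop_iff_nat 1).1 ((he.add
      Real.tendsto_harmonic_sub_log_add_one).congr fun n => ?_)
    rw [hS]
    simp only
    rw [Finset.sum_Ico_eq_sum_range, Nat.add_sub_cancel, harmonic]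
    push_cast
    rw [← add_sub_assoc, ← Finset.sum_add_distrib]
    congr 1
    refine Finset.sum_congr rfl fun i _ => ?_
    rw [add_comm 1 i, add_comm (1 : ℝ)]
    have : (0 : ℝ) < (i : ℝ) + 1 := by positivity
    field_simp
    ring
  set b : ℕ → ℝ := fun k => Real.exp (γ * (S k - Real.log k)) with hb
  have hbt : Tendsto b atTop (𝓝 (Real.exp (γ * (c + Real.eulerMascheroniConstant)))) :=
    (Real.continuous_exp.tendsto _).comp (hSlog.const_mul γ)
  have hexp : ∀ k : ℕ, 1 ≤ k → Real.exp (γ * S k) = (k : ℝ) ^ γ * b k := by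
    intro k hk
    rw [Real.rpow_def_of_pos (by exact_mod_cast hk), hb, ← Real.exp_add]
    ring_nf
  have hmain := (tendsto_weighted_sum hγ hτ hbt).div hbt (Real.exp_pos _).ne'
  rw [mul_div_cancel_right₀ _ (Real.exp_pos _).ne'] at hmain
  refine hmain.congr' ?_
  filter_upwards [eventually_ge_atTop 1] with k hk
  have hk0 : (0 : ℝ) < k := by exact_mod_cast hk
  have hbk : 0 < b k := Real.exp_pos _
  rw [Pi.div_apply, div_div, Finset.sum_div, Finset.mul_sum]
  refine Finset.sum_congr rfl fun j hj => ?_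
  obtain ⟨hj1, hjk⟩ := Finset.mem_Ico.1 hj
  have hsub : ∑ h ∈ Finset.Ico j k, e h / (h : ℝ) = S k - S j :=
    (eq_sub_of_add_eq' (Finset.sum_Ico_consecutive _ hj1 hjk.le))
  have h1 : Real.exp (-γ * (S k - S j)) = (j : ℝ) ^ γ * b j / ((k : ℝ) ^ γ * b k) := by
    rw [← hexp j hj1, ← hexp k hk, ← Real.exp_sub]
    ring_nf
  rw [hsub, h1, Real.rpow_add hk0]
  have h2 := Real.rpow_pos_of_pos hk0 τ
  have h3 := Real.rpow_pos_of_pos hk0 γ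
  field_simp

lemma sum_rpow_increment_le {τ : ℝ} (hτ : 0 < τ) (k : ℕ) :
    ∑ j ∈ Finset.Ico 1 k, ((j : ℝ) ^ τ - ((j : ℝ) - 1) ^ τ) ≤ (k : ℝ) ^ τ := by
  rcases k with _ | n
  · simp [Real.zero_rpow hτ.ne']
  · have h := Finset.sum_range_sub (fun i : ℕ => (i : ℝ) ^ τ) n
    rw [Finset.sum_Ico_eq_sum_range, Nat.add_sub_cancel]
    have h2 : ∑ i ∈ Finset.range n, ((((1 + i : ℕ) : ℝ)) ^ τ - (((1 + i : ℕ) : ℝ) - 1) ^ τ)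
        = (n : ℝ) ^ τ := by
      simp only [Nat.cast_zero, Real.zero_rpow hτ.ne', sub_zero] at h
      rw [← h]
      refine Finset.sum_congr rfl fun i _ => ?_
      push_cast
      rw [add_comm (1 : ℝ), add_sub_cancel_right]
    rw [h2]
    exact Real.rpow_le_rpow (by positivity) (by push_cast; linarith) hτ.le

lemma rpow_increment_nonneg {τ : ℝ} (hτ : 0 < τ) {j : ℕ} (hj : 1 ≤ j) :
    0 ≤ (j : ℝ) ^ τ - ((j : ℝ) - 1) ^ τ := by
  have : (1 : ℝ) ≤ j := by exact_mod_cast hj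
  exact sub_nonneg.2 (Real.rpow_le_rpow (by linarith) (by linarith) hτ.le)

lemma exp_neg_mul_sum_le_one {γ : ℝ} (hγ : 0 < γ) {e : ℕ → ℝ} {j k : ℕ}
    (he : ∀ h ∈ Finset.Ico j k, 0 ≤ e h) :
    Real.exp (-γ * ∑ h ∈ Finset.Ico j k, e h / (h : ℝ)) ≤ 1 := by
  refine Real.exp_le_one_iff.2 (mul_nonpos_of_nonpos_of_nonneg (by linarith) ?_)
  exact Finset.sum_nonneg fun h hh => div_nonneg (he h hh) (Nat.cast_nonneg h)

end Deterministic

/-! ### Exponential variables and the two limits -/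

/-- `∑ (E h - 1) / h` converges almost surely for independent standard exponentials `E h`. -/
lemma ae_exists_tendsto_sum_exponential {Ω : Type*} [MeasurableSpace Ω] (P : Measure Ω)
    [IsProbabilityMeasure P] (E : ℕ → Ω → ℝ)
    (hlaw : ∀ h : ℕ, 1 ≤ h → HasLaw (E h) (expMeasure 1) P)
    (hindep : iIndepFun (fun h : ℕ => E (h + 1)) P) :
    ∀ᵐ ω ∂P, ∃ c, Tendsto (fun n => ∑ i ∈ Finset.range n, (E (i + 1) ω - 1) / ((i : ℝ) + 1))
      atTop (𝓝 c) := by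
  have hE : ∀ i, HasLaw (E (i + 1)) (expMeasure 1) P := fun i => hlaw _ (by lia)
  have hE2 : ∀ i, MemLp (E (i + 1)) 2 P := fun i => by
    have h := memLp_two_id_expMeasure
    rw [← (hE i).map_eq] at h
    exact h.comp_of_map (hE i).aemeasurable
  have hE1 : ∀ i, Integrable (E (i + 1)) P := fun i => (hE2 i).integrable one_le_two
  have hsub : ∀ i, MemLp (fun ω => E (i + 1) ω - 1) 2 P := fun i => (hE2 i).sub (memLp_const 1)
  refine ae_exists_tendsto_sum (X := fun i ω => (E (i + 1) ω - 1) / ((i : ℝ) + 1)) ?_ ?_ ?_ ?_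
  · exact hindep.comp (fun i x => (x - 1) / ((i : ℝ) + 1)) fun i => by fun_prop
  · intro i
    simpa only [div_eq_inv_mul] using (hsub i).const_mul ((i : ℝ) + 1)⁻¹
  · intro i
    rw [integral_div, integral_sub (hE1 i) (integrable_const 1), (hE i).integral_eq,
      integral_id_expMeasure]
    simp
  · have hv : ∀ i : ℕ, Var[fun ω => (E (i + 1) ω - 1) / ((i : ℝ) + 1); P]
        = Var[id; expMeasure 1] * (1 / ((i + 1 : ℕ) : ℝ) ^ 2) := by
      intro i
      simp only [div_eq_inv_mul]
      rw [variance_const_mul, variance_sub_const (hE i).aemeasurable.aestronglyMeasurable,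
        (hE i).variance_eq]
      push_cast
      field_simp
    simp only [hv]
    exact ((summable_nat_add_iff 1).2
      (Real.summable_one_div_nat_pow.2 one_lt_two)).mul_left _


theorem proposition3 {Ω : Type*} [MeasurableSpace Ω] (P : Measure Ω) [IsProbabilityMeasure P]
    (E : ℕ → Ω → ℝ)
    (hlaw : ∀ h : ℕ, 1 ≤ h → HasLaw (E h) (expMeasure 1) P)
    (hindep : iIndepFun (fun h : ℕ => E (h + 1)) P)
    (γ τ : ℝ) (hγ : 0 < γ) (hτ : 0 < τ) :
    Tendsto (fun k : ℕ => (1 / (k : ℝ)) * ∑ j ∈ Finset.Ico 1 k,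
        (k : ℝ) ^ (1 - τ) * ((j : ℝ) ^ τ - ((j : ℝ) - 1) ^ τ) *
          ∫ ω, Real.exp (-γ * ∑ h ∈ Finset.Ico j k, E h ω / (h : ℝ)) ∂P)
      atTop (𝓝 (τ / (τ + γ))) ∧
    ∀ᵐ ω ∂P, Tendsto (fun k : ℕ => (1 / (k : ℝ) ^ τ) * ∑ j ∈ Finset.Ico 1 k,
        ((j : ℝ) ^ τ - ((j : ℝ) - 1) ^ τ) *
          Real.exp (-γ * ∑ h ∈ Finset.Ico j k, E h ω / (h : ℝ)))
      atTop (𝓝 (τ / (τ + γ))) := by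
  have hae : ∀ᵐ ω ∂P, Tendsto (fun k : ℕ => (1 / (k : ℝ) ^ τ) * ∑ j ∈ Finset.Ico 1 k,
        ((j : ℝ) ^ τ - ((j : ℝ) - 1) ^ τ) *
          Real.exp (-γ * ∑ h ∈ Finset.Ico j k, E h ω / (h : ℝ)))
      atTop (𝓝 (τ / (τ + γ))) := by
    filter_upwards [ae_exists_tendsto_sum_exponential P E hlaw hindep] with ω ⟨c, hc⟩
    exact tendsto_discounted_mean hγ hτ (e := fun h => E h ω) hc
  refine ⟨?_, hae⟩
  have hnn : ∀ᵐ ω ∂P, ∀ h, 1 ≤ h → 0 ≤ E h ω := by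
    refine ae_all_iff.2 fun h => ?_
    by_cases hh : 1 ≤ h
    · have h1 := ae_nonneg_expMeasure
      rw [← (hlaw h hh).map_eq] at h1
      filter_upwards [ae_of_ae_map (hlaw h hh).aemeasurable h1] with ω hω _ using hω
    · exact ae_of_all _ fun ω h1 => absurd h1 hh
  have hle : ∀ᵐ ω ∂P, ∀ j k : ℕ, 1 ≤ j →
      Real.exp (-γ * ∑ h ∈ Finset.Ico j k, E h ω / (h : ℝ)) ≤ 1 := by
    filter_upwards [hnn] with ω hω j k hj
    exact exp_neg_mul_sum_le_one hγ (e := fun h => E h ω)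
      fun h hh => hω h (hj.trans (Finset.mem_Ico.1 hh).1)
  have hmeas : ∀ j k : ℕ, 1 ≤ j → AEStronglyMeasurable
      (fun ω => Real.exp (-γ * ∑ h ∈ Finset.Ico j k, E h ω / (h : ℝ))) P := by
    intro j k hj
    refine (Real.measurable_exp.comp_aemeasurable (AEMeasurable.const_mul
      (Finset.aemeasurable_fun_sum _ fun h hh => ?_) _)).aestronglyMeasurable
    exact (hlaw h (hj.trans (Finset.mem_Ico.1 hh).1)).aemeasurable.div_const _
  have hint : ∀ j k : ℕ, 1 ≤ j → Integrable
      (fun ω => Real.exp (-γ * ∑ h ∈ Finset.Ico j k, E h ω / (h : ℝ))) P := by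
    intro j k hj
    refine Integrable.of_bound (hmeas j k hj) 1 ?_
    filter_upwards [hle] with ω hω
    rw [Real.norm_eq_abs, Real.abs_exp]
    exact hω j k hj
  have hdct := tendsto_integral_of_dominated_convergence (μ := P) (fun _ => (1 : ℝ))
    (fun k => (Finset.aestronglyMeasurable_fun_sum _ fun j hj =>
      (hmeas j k (Finset.mem_Ico.1 hj).1).const_mul
        ((j : ℝ) ^ τ - ((j : ℝ) - 1) ^ τ)).const_mul (1 / (k : ℝ) ^ τ))
    (integrable_const 1) (fun k => ?_) hae
  · simp only [integral_const, probReal_univ, one_smul] at hdct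
    refine hdct.congr' ?_
    filter_upwards [eventually_ge_atTop 1] with k hk
    have hk0 : (0 : ℝ) < k := by exact_mod_cast hk
    rw [integral_const_mul, integral_finsetSum _ fun j hj =>
      (hint j k (Finset.mem_Ico.1 hj).1).const_mul _, Finset.mul_sum, Finset.mul_sum]
    refine Finset.sum_congr rfl fun j _ => ?_
    rw [integral_const_mul, Real.rpow_sub hk0, Real.rpow_one]
    have h2 := Real.rpow_pos_of_pos hk0 τ
    field_simp
  · filter_upwards [hle] with ω hω
    have hk : (0 : ℝ) ≤ (k : ℝ) ^ τ := by positivity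
    have hterm : ∀ j ∈ Finset.Ico 1 k, 0 ≤ (j : ℝ) ^ τ - ((j : ℝ) - 1) ^ τ := fun j hj =>
      rpow_increment_nonneg hτ (Finset.mem_Ico.1 hj).1
    rw [Real.norm_eq_abs, abs_of_nonneg (mul_nonneg (by positivity)
      (Finset.sum_nonneg fun j hj => mul_nonneg (hterm j hj) (Real.exp_pos _).le)),
      one_div_mul_eq_div]
    refine div_le_one_of_le₀ (le_trans (Finset.sum_le_sum fun j hj => ?_)
      (sum_rpow_increment_le hτ k)) hk
    exact mul_le_of_le_one_right (hterm j hj) (hω j k (Finset.mem_Ico.1 hj).1)
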